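/- Let $\widehat{\mathbb Z}=\varprojlim_n \mathbb Z/n\mathbb Z$ be the ring of profinite integers, and let $\widehat{\mathbb Z}[[t^{\widehat{\mathbb Z}}]]=\varprojlim_n \widehat{\mathbb Z}[t^{\mathbb Z/n\mathbb Z}]$ be the completed group ring, where $n$ runs over the positive integers ordered by divisibility and $\widehat{\mathbb Z}[t^{\mathbb Z/n\mathbb Z}]$ is the group ring of $\mathbb Z/n\mathbb Z$ over $\widehat{\mathbb Z}$. For $v\in\widehat{\mathbb Z}$ let $t^v=(t^{v \bmod n})_n\in\widehat{\mathbb Z}[[t^{\widehat{\mathbb Z}}]]$, and for $g\in\mathbb Z[t]$ let $g(t^v)\in\widehat{\mathbb Z}[[t^{\widehat{\mathbb Z}}]]$ be the result of substituting $t^v$ for $t$; the case $v=1$ gives the natural map $\mathbb Z[t]\to\widehat{\mathbb Z}[[t^{\widehat{\mathbb Z}}]]$. A polynomial $\sum_{i=0}^d a_i t^{d-i}\in\mathbb Z[t]$ of degree $d$ is called reciprocal if $a_i=a_{d-i}$ for all $0\le i\le d$ (the zero polynomial is regarded as reciprocal). Let $f(t),g(t)\in\mathbb Z[t]$ be reciprocal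 polynomials and let $v$ be a unit of $\widehat{\mathbb Z}$. Suppose that the principal ideals $(f(t))$ and $(g(t^v))$ of $\widehat{\mathbb Z}[[t^{\widehat{\mathbb Z}}]]$ are equal. Then $f(t)=u\,g(t)$ for some unit $u$ of the Laurent polynomial ring $\mathbb Z[t,t^{-1}]$. -/

import Mathlib

open scoped Polynomial LaurentPolynomial

/-- The ring of profinite integers: the inverse limit of the rings `ℤ/nℤ` over the positive
integers ordered by divisibility, realised as the compatible families in the product. -/
def ZHat : Subring (∀ n : ℕ+, ZMod (n : ℕ)) where
  carrier := {x | ∀ (m n : ℕ+) (h : (m : ℕ) ∣ (n : ℕ)), ZMod.castHom h (ZMod (m : ℕ)) (x n) = x m}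
  mul_mem' hx hy m n h := by rw [Pi.mul_apply, Pi.mul_apply, map_mul, hx m n h, hy m n h]
  one_mem' m n h := by rw [Pi.one_apply, Pi.one_apply, map_one]
  add_mem' hx hy m n h := by rw [Pi.add_apply, Pi.add_apply, map_add, hx m n h, hy m n h]
  zero_mem' m n h := by rw [Pi.zero_apply, Pi.zero_apply, map_zero]
  neg_mem' hx m n h := by rw [Pi.neg_apply, Pi.neg_apply, map_neg, hx m n h]

/-- The transition map between the group rings of `ℤ/nℤ` and `ℤ/mℤ` with coefficients in the
profinite integers, for `m ∣ n`, induced by the reduction of the group `ℤ/nℤ → ℤ/mℤ`. -/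
noncomputable def groupRingReduction {m n : ℕ+} (h : (m : ℕ) ∣ (n : ℕ)) :
    AddMonoidAlgebra ZHat (ZMod (n : ℕ)) →+* AddMonoidAlgebra ZHat (ZMod (m : ℕ)) :=
  AddMonoidAlgebra.mapDomainRingHom ZHat
    (ZMod.castHom h (ZMod (m : ℕ)) : ZMod (n : ℕ) →+ ZMod (m : ℕ))

/-- The completed group ring of the (multiplicatively written) group `t ^ ZHat` with coefficients
in the profinite integers: the inverse limit over `n` of the group rings of `ℤ/nℤ`. -/
noncomputable def CompletedGroupRing :
    Subring (∀ n : ℕ+, AddMonoidAlgebra ZHat (ZMod (n : ℕ))) where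
  carrier := {x | ∀ (m n : ℕ+) (h : (m : ℕ) ∣ (n : ℕ)), groupRingReduction h (x n) = x m}
  mul_mem' hx hy m n h := by rw [Pi.mul_apply, Pi.mul_apply, map_mul, hx m n h, hy m n h]
  one_mem' m n h := by rw [Pi.one_apply, Pi.one_apply, map_one]
  add_mem' hx hy m n h := by rw [Pi.add_apply, Pi.add_apply, map_add, hx m n h, hy m n h]
  zero_mem' m n h := by rw [Pi.zero_apply, Pi.zero_apply, map_zero]
  neg_mem' hx m n h := by rw [Pi.neg_apply, Pi.neg_apply, map_neg, hx m n h]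

/-- The group element `t ^ v` of the completed group ring, for a profinite integer `v`: its
component at `n` is the group element `v mod n` of the group ring of `ℤ/nℤ`. -/
noncomputable def tPow (v : ZHat) : CompletedGroupRing :=
  ⟨fun n => AddMonoidAlgebra.single (v.1 n) 1, fun m n h => by
    have hv := v.2 m n h
    simp only [groupRingReduction, AddMonoidAlgebra.mapDomainRingHom_apply,
      AddMonoidAlgebra.mapDomain_single]
    exact congrArg (fun a => AddMonoidAlgebra.single a (1 : ZHat)) hv⟩

/-- The value `f(t ^ v)` of an integer polynomial in the completed group ring. For `v = 1` this is
the image `f(t)` of `f` under the inclusion of `ℤ[t]`. -/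
noncomputable def evalTPow (v : ZHat) (f : ℤ[X]) : CompletedGroupRing :=
  Polynomial.aeval (tPow v) f

/-- A polynomial of degree `d` is reciprocal if its coefficients satisfy `a_i = a_(d-i)` for all
`0 ≤ i ≤ d`. -/
def IsReciprocal (f : ℤ[X]) : Prop :=
  ∀ i ≤ f.natDegree, f.coeff i = f.coeff (f.natDegree - i)

/-! Reducing modulo `X ^ n - 1` and `N` turns the equality of ideals into two families of
congruences, `TwistedMem`: `f` is a multiple of `g(X ^ a)` and `g` of `f(X ^ b)`, where `a` and `b`
are the residues mod `n` of `v` and its inverse.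

A cyclotomic factor of `f` also divides `g`, because its exponent twist is invertible, and it
cancels from both congruences (`TwistedMem.of_cyclotomic_mul`). So no root need be a root of unity.
The resultants with `X ^ n - 1` are then nonzero and, since `ζ ↦ ζ ^ a` permutes the `n`-th roots of
unity, divide each other: they agree up to a sign depending on `n`.

Their squares, `lc ^ (2n) * ∏ (α ^ n - 1) ^ 2`, are exponential sums in `n`. Independence of the
characters `n ↦ u ^ n` lifts the equality to the group algebra of `ℂˣ`, where an ordering of the
relevant elements recovers the roots up to inversion
(`multiset_eq_of_forall_prod_pow_sub_one_sq_eq`). Reciprocity makes the root multisets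
inversion-stable, so they coincide, and the leading coefficients agree up to sign. -/

open Polynomial

/-! ### Reduction to congruences in `ℤ[X]` -/

/-- Membership of `f` in the ideal `(g(X ^ a), X ^ n - 1, N)` of `ℤ[X]` for all `n` and `N`, where
the exponent `a` depends on `n`. -/
def TwistedMem (a : ℕ+ → ℕ) (f g : ℤ[X]) : Prop :=
  ∀ n N : ℕ+, ∃ w q r : ℤ[X],
    f = w * g.comp (X ^ a n) + (X ^ (n : ℕ) - 1) * q + C (N : ℤ) * r

/-- The residues of a profinite integer, as natural numbers. -/
def residue (v : ZHat) (n : ℕ+) : ℕ := (v.1 n).val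

theorem natCast_residue (v : ZHat) (n : ℕ+) : (residue v n : ZMod n) = v.1 n :=
  ZMod.natCast_zmod_val _

theorem residue_modEq (v : ZHat) {m n : ℕ+} (h : (m : ℕ) ∣ n) :
    residue v n ≡ residue v m [MOD m] := by
  rw [← ZMod.natCast_eq_natCast_iff, natCast_residue, ← v.2 m n h, ← natCast_residue v n,
    map_natCast]

theorem residue_mul_inv_modEq (v : ZHatˣ) (n : ℕ+) :
    residue (v : ZHat) n * residue ((v⁻¹ : ZHatˣ) : ZHat) n ≡ 1 [MOD n] := by
  rw [← ZMod.natCast_eq_natCast_iff, Nat.cast_mul, natCast_residue, natCast_residue, Nat.cast_one]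
  have := congrArg (fun x : ZHat => x.1 n) v.mul_inv
  exact this

theorem residue_coprime (v : ZHatˣ) (n : ℕ+) : (residue (v : ZHat) n).Coprime n :=
  Nat.coprime_of_mul_modEq_one _ (residue_mul_inv_modEq v n)

/-- The quotient of `ℤ[X]` by `(X ^ n - 1, N)`. -/
abbrev FiniteLevel (n N : ℕ+) : Type :=
  ℤ[X] ⧸ Ideal.span {(X ^ (n : ℕ) - 1 : ℤ[X]), C (N : ℤ)}

namespace FiniteLevel

variable (n N : ℕ+)

theorem mk_eq_zero_iff (p : ℤ[X]) :
    (Ideal.Quotient.mk (Ideal.span {(X ^ (n : ℕ) - 1 : ℤ[X]), C (N : ℤ)}) p) = 0 ↔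
      ∃ q r, p = (X ^ (n : ℕ) - 1) * q + C (N : ℤ) * r := by
  rw [Ideal.Quotient.eq_zero_iff_mem, Ideal.mem_span_pair]
  constructor
  · rintro ⟨q, r, h⟩
    exact ⟨q, r, by rw [← h]; ring⟩
  · rintro ⟨q, r, h⟩
    exact ⟨q, r, by rw [h]; ring⟩

/-- The class of `X`. -/
noncomputable def gen : FiniteLevel n N := Ideal.Quotient.mk _ X

theorem gen_pow : gen n N ^ (n : ℕ) = 1 := by
  rw [← sub_eq_zero, gen, ← map_pow, ← map_one (Ideal.Quotient.mk _), ← map_sub, mk_eq_zero_iff]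
  exact ⟨1, 0, by simp⟩

theorem gen_pow_eq_of_modEq {a b : ℕ} (h : a ≡ b [MOD n]) : gen n N ^ a = gen n N ^ b := by
  rw [← pow_mod_orderOf, ← pow_mod_orderOf _ b]
  congr 1
  exact h.of_dvd (orderOf_dvd_of_pow_eq_one (gen_pow n N))

/-- The powers of the class of `X`, with exponents in `ℤ/nℤ`. -/
noncomputable def powHom : Multiplicative (ZMod n) →* FiniteLevel n N where
  toFun j := gen n N ^ (Multiplicative.toAdd j).val
  map_one' := by simp
  map_mul' i j := by
    rw [← pow_add]
    apply gen_pow_eq_of_modEq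
    rw [← ZMod.natCast_eq_natCast_iff]
    simp

/-- The map from the profinite integers factoring through `ℤ/Nℤ`. -/
noncomputable def scalarHom : ZHat →+* FiniteLevel n N :=
  ((Ideal.Quotient.lift (Ideal.span {((N : ℕ) : ℤ)}) (Int.castRingHom (FiniteLevel n N)) (by
    intro a ha
    obtain ⟨c, rfl⟩ := Ideal.mem_span_singleton.1 ha
    rw [eq_intCast, Int.cast_mul, ← map_intCast
      (Ideal.Quotient.mk (Ideal.span {(X ^ (n : ℕ) - 1 : ℤ[X]), C (N : ℤ)})) ((N : ℕ) : ℤ),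
      (mk_eq_zero_iff n N _).2 ⟨0, 1, by simp⟩, zero_mul])).comp
    (Int.quotientSpanNatEquivZMod (N : ℕ)).symm.toRingHom).comp
    ((Pi.evalRingHom (fun n : ℕ+ => ZMod (n : ℕ)) N).comp ZHat.subtype)

/-- The reduction of the completed group ring. -/
noncomputable def reduction : CompletedGroupRing →+* FiniteLevel n N :=
  ((AddMonoidAlgebra.liftNCRingHom (scalarHom n N) (powHom n N) fun _ _ => mul_comm _ _).comp
    (Pi.evalRingHom (fun n : ℕ+ => AddMonoidAlgebra ZHat (ZMod (n : ℕ))) n)).comp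
    CompletedGroupRing.subtype

theorem reduction_tPow (v : ZHat) : reduction n N (tPow v) = gen n N ^ residue v n := by
  simp [reduction, tPow, powHom, residue]

theorem reduction_evalTPow (v : ZHat) (f : ℤ[X]) :
    reduction n N (evalTPow v f) = Ideal.Quotient.mk _ (f.comp (X ^ residue v n)) := by
  have : (reduction n N).comp (Polynomial.aeval (R := ℤ) (tPow v)).toRingHom =
      (Ideal.Quotient.mk _).comp (compRingHom (X ^ residue v n)) := by
    apply Polynomial.ringHom_ext
    · simp
    · simpa [gen] using reduction_tPow n N v
  exact congrArg (fun φ => φ f) this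

theorem mk_comp_eq_of_modEq {a b : ℕ} (h : a ≡ b [MOD n]) (f : ℤ[X]) :
    (Ideal.Quotient.mk _ (f.comp (X ^ a)) : FiniteLevel n N) =
      Ideal.Quotient.mk _ (f.comp (X ^ b)) := by
  have : (Ideal.Quotient.mk _ : ℤ[X] →+* FiniteLevel n N).comp (compRingHom (X ^ a)) =
      (Ideal.Quotient.mk _).comp (compRingHom (X ^ b)) := by
    apply Polynomial.ringHom_ext
    · simp
    · simpa [gen] using gen_pow_eq_of_modEq n N h
  exact congrArg (fun φ => φ f) this

end FiniteLevel

open FiniteLevel in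
theorem exists_comp_eq_of_mem_span {v w : ZHat} {f g : ℤ[X]}
    (h : evalTPow v f ∈ Ideal.span {evalTPow w g}) (n N : ℕ+) :
    ∃ y q r : ℤ[X], f.comp (X ^ residue v n) =
      y * g.comp (X ^ residue w n) + (X ^ (n : ℕ) - 1) * q + C (N : ℤ) * r := by
  obtain ⟨y, hy⟩ := Ideal.mem_span_singleton'.1 h
  obtain ⟨y', hy'⟩ := Ideal.Quotient.mk_surjective (reduction n N y)
  have := congrArg (reduction n N) hy
  rw [map_mul, reduction_evalTPow, reduction_evalTPow, ← hy', ← map_mul, eq_comm, ← sub_eq_zero,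
    ← map_sub, mk_eq_zero_iff] at this
  obtain ⟨q, r, e⟩ := this
  exact ⟨y', q, r, by rw [add_assoc, ← e]; ring⟩

open FiniteLevel in
theorem exists_comp_sub_comp_eq {n : ℕ+} {a b : ℕ} (h : a ≡ b [MOD n]) (f : ℤ[X]) (N : ℕ+) :
    ∃ q r : ℤ[X], f.comp (X ^ a) - f.comp (X ^ b) = (X ^ (n : ℕ) - 1) * q + C (N : ℤ) * r := by
  rw [← mk_eq_zero_iff, map_sub, sub_eq_zero]
  exact mk_comp_eq_of_modEq n N h f

theorem residue_one_modEq (n : ℕ+) : residue (1 : ZHat) n ≡ 1 [MOD n] := by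
  rw [← ZMod.natCast_eq_natCast_iff, natCast_residue]
  simp

theorem twistedMem_of_mem_span {v : ZHat} {f g : ℤ[X]}
    (h : evalTPow 1 f ∈ Ideal.span {evalTPow v g}) : TwistedMem (residue v) f g := by
  intro n N
  obtain ⟨y, q, r, e⟩ := exists_comp_eq_of_mem_span h n N
  obtain ⟨q', r', e'⟩ := exists_comp_sub_comp_eq (residue_one_modEq n) f N
  rw [pow_one, comp_X] at e'
  exact ⟨y, q - q', r - r', by linear_combination e - e'⟩

/-- Substituting `X ^ b` for `X` preserves the ideal `(X ^ n - 1, N)` and undoes the twist by `a`,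
as `a * b ≡ 1` mod `n`. -/
theorem twistedMem_inv_of_mem_span {v : ZHatˣ} {f g : ℤ[X]}
    (h : evalTPow (v : ZHat) g ∈ Ideal.span {evalTPow 1 f}) :
    TwistedMem (residue ((v⁻¹ : ZHatˣ) : ZHat)) g f := by
  intro n N
  obtain ⟨y, q, r, e⟩ := exists_comp_eq_of_mem_span h n N
  obtain ⟨q₁, r₁, e₁⟩ := exists_comp_sub_comp_eq (residue_one_modEq n) f N
  set a := residue (v : ZHat) n
  set b := residue ((v⁻¹ : ZHatˣ) : ZHat) n
  obtain ⟨q₂, r₂, e₂⟩ := exists_comp_sub_comp_eq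
    ((mul_comm b a ▸ residue_mul_inv_modEq v n : b * a ≡ 1 [MOD n])) g N
  obtain ⟨s, hs⟩ : (X ^ (n : ℕ) - 1 : ℤ[X]) ∣ (X ^ (n : ℕ) - 1 : ℤ[X]).comp (X ^ b) := by
    simpa [← pow_mul, mul_comm b] using sub_dvd_pow_sub_pow (X ^ (n : ℕ) : ℤ[X]) 1 b
  rw [pow_one, comp_X] at e₁ e₂
  have e₃ : g.comp (X ^ a) = y * f + (X ^ (n : ℕ) - 1) * (q + y * q₁) + C (N : ℤ) * (r + y * r₁) := by
    linear_combination e + y * e₁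
  have e₄ := congrArg (fun p : ℤ[X] => p.comp (X ^ b)) e₃
  simp only [comp_assoc, X_pow_comp, ← pow_mul, Polynomial.add_comp, mul_comp, hs,
    C_comp] at e₄
  exact ⟨y.comp (X ^ b), s * (q.comp (X ^ b) + y.comp (X ^ b) * q₁.comp (X ^ b)) - q₂,
    r.comp (X ^ b) + y.comp (X ^ b) * r₁.comp (X ^ b) - r₂, by linear_combination e₄ - e₂⟩

/-! ### Removal of cyclotomic factors -/

theorem Polynomial.Monic.dvd_of_dvd_C_mul {p r : ℤ[X]} (hp : p.Monic) {N : ℤ} (hN : N ≠ 0)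
    (h : p ∣ C N * r) : p ∣ r := by
  rw [← modByMonic_eq_zero_iff_dvd hp] at h ⊢
  rw [← smul_eq_C_mul, smul_modByMonic] at h
  exact (smul_eq_zero.1 h).resolve_left hN

theorem Polynomial.Monic.dvd_of_forall_dvd_sub_C_mul {p f : ℤ[X]} (hp : p.Monic)
    (h : ∀ N : ℕ+, ∃ r, p ∣ f - C (N : ℤ) * r) : p ∣ f := by
  rw [← modByMonic_eq_zero_iff_dvd hp]
  ext i
  rw [coeff_zero]
  -- This modulus exceeds the absolute value of the coefficient it must divide, forcing that
  -- coefficient to vanish.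
  obtain ⟨r, hr⟩ := h ⟨((f %ₘ p).coeff i).natAbs + 1, Nat.succ_pos _⟩
  rw [← modByMonic_eq_zero_iff_dvd hp, sub_modByMonic, sub_eq_zero, ← smul_eq_C_mul,
    smul_modByMonic] at hr
  apply Int.eq_zero_of_dvd_of_natAbs_lt_natAbs (d := ((((f %ₘ p).coeff i).natAbs + 1 : ℕ) : ℤ))
  · refine ⟨(r %ₘ p).coeff i, ?_⟩
    conv_lhs => rw [hr]
    rw [coeff_smul, smul_eq_mul, PNat.mk_coe]
  · rw [Int.natAbs_natCast]
    exact Nat.lt_succ_self _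

theorem cyclotomic_dvd_cyclotomic_comp_X_pow {k a : ℕ} (hk : 0 < k) (h : a.Coprime k) :
    cyclotomic k ℤ ∣ (cyclotomic k ℤ).comp (X ^ a) := by
  have hζ := Complex.isPrimitiveRoot_exp k hk.ne'
  conv_lhs => rw [cyclotomic_eq_minpoly hζ hk]
  refine minpoly.isIntegrallyClosed_dvd (hζ.isIntegral hk) ?_
  rw [aeval_comp, aeval_X_pow, ← eval_map_algebraMap, map_cyclotomic]
  exact (hζ.pow_of_coprime a h).isRoot_cyclotomic hk

/-- The cofactor contains the geometric sum of `N` powers of `X ^ (n * k)`, which is `N` modulo `X ^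
n - 1`. Hence a relation at level `n * k * N`, once divided by `cyclotomic k`, still gives one at
level `n`. -/
theorem X_pow_sub_one_eq_cyclotomic_mul (n k N : ℕ+) :
    ∃ c q r : ℤ[X], (X : ℤ[X]) ^ ((n * k * N : ℕ+) : ℕ) - 1 = cyclotomic k ℤ * c ∧
      c = (X ^ (n : ℕ) - 1) * q + C (N : ℤ) * r := by
  obtain ⟨d, hd⟩ : cyclotomic k ℤ ∣ X ^ ((n : ℕ) * k) - 1 :=
    (cyclotomic.dvd_X_pow_sub_one _ ℤ).trans
      (by simpa [← pow_mul, mul_comm] using sub_dvd_pow_sub_pow (X ^ (k : ℕ) : ℤ[X]) 1 n)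
  obtain ⟨e, he⟩ : (X ^ (n : ℕ) - 1 : ℤ[X]) ∣
      ∑ i ∈ Finset.range N, (X ^ ((n : ℕ) * k)) ^ i - C (N : ℤ) := by
    have : C (N : ℤ) = ∑ i ∈ Finset.range N, (1 : ℤ[X]) := by simp
    rw [this, ← Finset.sum_sub_distrib]
    refine Finset.dvd_sum fun i _ => ?_
    simpa [← pow_mul, mul_assoc] using sub_dvd_pow_sub_pow (X ^ (n : ℕ) : ℤ[X]) 1 (k * i)
  refine ⟨d * ∑ i ∈ Finset.range N, (X ^ ((n : ℕ) * k)) ^ i, d * e, d, ?_, ?_⟩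
  · rw [← mul_assoc, ← hd, mul_geom_sum, ← pow_mul]
    simp
  · linear_combination d * he

namespace TwistedMem

variable {a b : ℕ+ → ℕ} {f g : ℤ[X]}

theorem X_pow_sub_one_dvd (h : TwistedMem a f 0) (n : ℕ+) : (X ^ (n : ℕ) - 1 : ℤ[X]) ∣ f := by
  refine (monic_X_pow_sub_C 1 n.ne_zero).dvd_of_forall_dvd_sub_C_mul fun N => ?_
  obtain ⟨w, q, r, e⟩ := h n N
  exact ⟨r, q, by rw [e]; simp⟩

theorem eq_zero_of_zero_right (h : TwistedMem a f 0) : f = 0 := by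
  refine eq_zero_of_dvd_of_natDegree_lt (h.X_pow_sub_one_dvd f.natDegree.succPNat) ?_
  rw [← C_1, natDegree_X_pow_sub_C]
  exact Nat.lt_succ_self _

theorem cyclotomic_dvd (ha : ∀ n, (a n).Coprime n) (h : TwistedMem a f g) {k : ℕ+}
    (hk : cyclotomic k ℤ ∣ g) : cyclotomic k ℤ ∣ f := by
  refine (cyclotomic.monic _ ℤ).dvd_of_forall_dvd_sub_C_mul fun N => ?_
  obtain ⟨w, q, r, e⟩ := h k N
  refine ⟨r, ?_⟩
  rw [e, add_sub_cancel_right]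
  refine dvd_add (Dvd.dvd.mul_left ?_ _) ((cyclotomic.dvd_X_pow_sub_one _ ℤ).mul_right _)
  obtain ⟨g', rfl⟩ := hk
  rw [mul_comp]
  exact (cyclotomic_dvd_cyclotomic_comp_X_pow k.pos (ha k)).mul_right _

/-- At level `n * k * N` every term but `N * r` is visibly divisible by the monic `cyclotomic k`, so
`r` is too. After cancellation, the cofactor of `X ^ (n * k * N) - 1` lies in `(X ^ n - 1, N)`. -/
theorem of_cyclotomic_mul (ha : ∀ n, (a n).Coprime n)
    (hc : ∀ m n : ℕ+, (m : ℕ) ∣ n → a n ≡ a m [MOD m]) {k : ℕ+}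
    (h : TwistedMem a (cyclotomic k ℤ * f) (cyclotomic k ℤ * g)) : TwistedMem a f g := by
  intro n N
  obtain ⟨w, q, r, e⟩ := h (n * k * N) N
  obtain ⟨c, q₁, r₁, e₁, e₂⟩ := X_pow_sub_one_eq_cyclotomic_mul n k N
  have hcop : (a (n * k * N)).Coprime k := (ha (n * k * N)).coprime_dvd_right
    ⟨n * N, by push_cast; ring⟩
  obtain ⟨s, hs⟩ := cyclotomic_dvd_cyclotomic_comp_X_pow k.pos hcop
  obtain ⟨q₂, r₂, e₃⟩ := exists_comp_sub_comp_eq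
    (hc n (n * k * N) ⟨k * N, by push_cast; ring⟩) g N
  rw [mul_comp, hs, e₁] at e
  obtain ⟨r', rfl⟩ : cyclotomic k ℤ ∣ r :=
    (cyclotomic.monic _ ℤ).dvd_of_dvd_C_mul (N := (N : ℤ)) (by simp)
      ⟨f - w * (s * g.comp (X ^ a (n * k * N))) - c * q, by linear_combination -e⟩
  have e₄ : f = w * (s * g.comp (X ^ a (n * k * N))) + c * q + C (N : ℤ) * r' := by
    apply mul_left_cancel₀ (cyclotomic_ne_zero k ℤ)
    linear_combination e
  exact ⟨w * s, q₁ * q + w * s * q₂, r' + r₁ * q + w * s * r₂, by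
    linear_combination e₄ + q * e₂ + w * s * e₃⟩

end TwistedMem

theorem cyclotomic_dvd_of_aeval_eq_zero {f : ℤ[X]} {z : ℂ} (hz : aeval z f = 0) {n : ℕ}
    (hn : 0 < n) (h : z ^ n = 1) : ∃ k : ℕ+, cyclotomic k ℤ ∣ f := by
  have ho : 0 < orderOf z := orderOf_pos_iff.2 (isOfFinOrder_iff_pow_eq_one.2 ⟨n, hn, h⟩)
  refine ⟨⟨orderOf z, ho⟩, ?_⟩
  have hζ := IsPrimitiveRoot.orderOf z
  rw [PNat.mk_coe, cyclotomic_eq_minpoly hζ ho]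
  exact minpoly.isIntegrallyClosed_dvd (hζ.isIntegral ho) hz

/-- No complex root of `f` is a root of unity. -/
def NoRootOfUnity (f : ℤ[X]) : Prop :=
  ∀ z : ℂ, aeval z f = 0 → ∀ n : ℕ, 0 < n → z ^ n ≠ 1

theorem noRootOfUnity_of_forall_not_cyclotomic_dvd {f : ℤ[X]}
    (h : ∀ k : ℕ+, ¬ cyclotomic k ℤ ∣ f) : NoRootOfUnity f := fun _ hz _ hn e =>
  (cyclotomic_dvd_of_aeval_eq_zero hz hn e).elim h

theorem TwistedMem.exists_strip_cyclotomic {a b : ℕ+ → ℕ} (ha : ∀ n, (a n).Coprime n)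
    (hb : ∀ n, (b n).Coprime n) (hac : ∀ m n : ℕ+, (m : ℕ) ∣ n → a n ≡ a m [MOD m])
    (hbc : ∀ m n : ℕ+, (m : ℕ) ∣ n → b n ≡ b m [MOD m]) (f g : ℤ[X]) (hf : f ≠ 0)
    (hfg : TwistedMem a f g) (hgf : TwistedMem b g f) :
    ∃ P f₀ g₀ : ℤ[X], f = P * f₀ ∧ g = P * g₀ ∧ TwistedMem a f₀ g₀ ∧ TwistedMem b g₀ f₀ ∧
      NoRootOfUnity f₀ ∧ NoRootOfUnity g₀ ∧
      ∀ z : ℂ, aeval z P = 0 → ∃ n : ℕ, 0 < n ∧ z ^ n = 1 := by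
  induction hd : f.natDegree using Nat.strong_induction_on generalizing f g with
  | _ d ih =>
    by_cases h : ∃ k : ℕ+, cyclotomic k ℤ ∣ f
    · obtain ⟨k, hk⟩ := h
      obtain ⟨g', rfl⟩ := hgf.cyclotomic_dvd hb hk
      obtain ⟨f', rfl⟩ := hk
      have hf' := right_ne_zero_of_mul hf
      obtain ⟨P, f₀, g₀, rfl, rfl, h₁, h₂, h₃, h₄, h₅⟩ := ih f'.natDegree (by
        rw [← hd, natDegree_mul (cyclotomic_ne_zero k ℤ) hf', natDegree_cyclotomic]
        have := Nat.totient_pos.2 k.pos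
        omega) f' g' hf' (hfg.of_cyclotomic_mul ha hac) (hgf.of_cyclotomic_mul hb hbc) rfl
      refine ⟨cyclotomic k ℤ * P, f₀, g₀, by ring, by ring, h₁, h₂, h₃, h₄, fun z hz => ?_⟩
      rw [map_mul, mul_eq_zero] at hz
      refine hz.elim (fun hz => ⟨k, k.pos, ?_⟩) (h₅ z)
      obtain ⟨c, hc⟩ := cyclotomic.dvd_X_pow_sub_one k ℤ
      have := congrArg (aeval z) hc
      rw [map_mul, hz, zero_mul] at this
      simpa [sub_eq_zero] using this
    · push Not at h
      exact ⟨1, f, g, by simp, by simp, hfg, hgf, noRootOfUnity_of_forall_not_cyclotomic_dvd h,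
        noRootOfUnity_of_forall_not_cyclotomic_dvd fun k hk => h k (hfg.cyclotomic_dvd ha hk),
        by simp⟩

/-! ### Resultants with `X ^ n - 1` -/

/-- The resultant of `X ^ n - 1` and `h`. -/
noncomputable def cyclicResultant (n : ℕ) (h : ℤ[X]) : ℤ :=
  resultant (X ^ n - 1) h n h.natDegree

theorem natDegree_map_complex (h : ℤ[X]) :
    (h.map (algebraMap ℤ ℂ)).natDegree = h.natDegree :=
  natDegree_map_eq_of_injective (algebraMap ℤ ℂ).injective_int h

theorem cyclicResultant_eq_prod {n : ℕ} (hn : 0 < n) (h : ℤ[X]) :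
    (cyclicResultant n h : ℂ) = ∏ ζ ∈ nthRootsFinset n (1 : ℂ), aeval ζ h := by
  have hd : (X ^ n - 1 : ℂ[X]).natDegree = n := by rw [← C_1, natDegree_X_pow_sub_C]
  have hm : (X ^ n - 1 : ℂ[X]).Monic := monic_X_pow_sub_C 1 hn.ne'
  have := resultant_eq_prod_eval (X ^ n - 1 : ℂ[X]) (h.map (algebraMap ℤ ℂ)) h.natDegree
    (natDegree_map_complex h).le (IsAlgClosed.splits _)
  rw [hd, hm.leadingCoeff, one_pow, one_mul] at this
  have hmap : (X ^ n - 1 : ℂ[X]) = (X ^ n - 1 : ℤ[X]).map (algebraMap ℤ ℂ) := by simp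
  rw [hmap, resultant_map_map, ← hmap] at this
  rw [cyclicResultant, ← eq_intCast (algebraMap ℤ ℂ), this, Finset.prod, nthRootsFinset_def,
    Multiset.toFinset_val, (Complex.isPrimitiveRoot_exp n hn.ne').nthRoots_one_nodup.dedup]
  simp [nthRoots, eval_map_algebraMap, -algebraMap_int_eq]

/-- Squaring absorbs the sign that comes from swapping the arguments of the resultant. -/
theorem cyclicResultant_sq (n : ℕ) (h : ℤ[X]) :
    (cyclicResultant n h : ℂ) ^ 2 = (h.leadingCoeff : ℂ) ^ (2 * n) *
      ((h.map (algebraMap ℤ ℂ)).roots.map fun α => (α ^ n - 1) ^ 2).prod := by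
  have := resultant_eq_prod_eval (h.map (algebraMap ℤ ℂ)) (X ^ n - 1 : ℂ[X]) n
    (by rw [← C_1, natDegree_X_pow_sub_C]) (IsAlgClosed.splits _)
  have hmap : (X ^ n - 1 : ℂ[X]) = (X ^ n - 1 : ℤ[X]).map (algebraMap ℤ ℂ) := by simp
  rw [hmap, resultant_map_map, ← hmap, natDegree_map_complex,
    leadingCoeff_map_of_injective (algebraMap ℤ ℂ).injective_int] at this
  rw [cyclicResultant, resultant_comm, ← eq_intCast (algebraMap ℤ ℂ), map_mul, this,
    Multiset.prod_map_pow, map_pow, mul_pow, ← pow_mul, mul_comm _ 2, pow_mul]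
  simp [mul_pow, ← pow_mul, mul_comm n 2]

theorem prod_nthRootsFinset_pow {n a : ℕ} (hn : 0 < n) (ha : a.Coprime n) (F : ℂ → ℂ) :
    ∏ ζ ∈ nthRootsFinset n (1 : ℂ), F (ζ ^ a) = ∏ ζ ∈ nthRootsFinset n (1 : ℂ), F ζ := by
  have hmaps : Set.MapsTo (fun ζ : ℂ => ζ ^ a) (nthRootsFinset n (1 : ℂ))
      (nthRootsFinset n (1 : ℂ)) := by
    intro ζ hζ
    rw [Finset.mem_coe, mem_nthRootsFinset hn] at hζ ⊢
    rw [← pow_mul, mul_comm, pow_mul, hζ, one_pow]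
  have hinj : Set.InjOn (fun ζ : ℂ => ζ ^ a) (nthRootsFinset n (1 : ℂ)) := by
    intro ζ hζ η hη e
    rw [Finset.mem_coe, mem_nthRootsFinset hn] at hζ hη
    have hη0 : η ≠ 0 := by
      rintro rfl
      simp [hn.ne'] at hη
    have h₁ : (ζ / η) ^ a = 1 := by
      rw [div_pow, show ζ ^ a = η ^ a from e, div_self (pow_ne_zero _ hη0)]
    have h₂ : (ζ / η) ^ n = 1 := by rw [div_pow, hζ, hη, div_one]
    -- The order of `ζ / η` divides both `a` and `n`, which are coprime.
    have := Nat.dvd_gcd (orderOf_dvd_of_pow_eq_one h₁) (orderOf_dvd_of_pow_eq_one h₂)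
    rw [ha, Nat.dvd_one, orderOf_eq_one_iff, div_eq_one_iff_eq hη0] at this
    exact this
  exact Finset.prod_nbij (fun ζ => ζ ^ a) hmaps hinj
    (Finset.surjOn_of_injOn_of_card_le _ hmaps hinj le_rfl) fun _ _ => rfl

theorem NoRootOfUnity.aeval_ne_zero {f : ℤ[X]} (h : NoRootOfUnity f) {n : ℕ} (hn : 0 < n) {ζ : ℂ}
    (hζ : ζ ∈ nthRootsFinset n (1 : ℂ)) : aeval ζ f ≠ 0 := fun e =>
  h ζ e n hn ((mem_nthRootsFinset hn 1).1 hζ)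

theorem cyclicResultant_comp_X_pow {n a : ℕ} (hn : 0 < n) (ha : a.Coprime n) (g : ℤ[X]) :
    cyclicResultant n (g.comp (X ^ a)) = cyclicResultant n g := by
  rw [← Int.cast_inj (α := ℂ), cyclicResultant_eq_prod hn, cyclicResultant_eq_prod hn,
    ← prod_nthRootsFinset_pow hn ha fun ζ => aeval ζ g]
  simp [aeval_comp]

theorem TwistedMem.cyclicResultant_dvd {a : ℕ+ → ℕ} (ha : ∀ n, (a n).Coprime n) {f g : ℤ[X]}
    (h : TwistedMem a f g) (hg : NoRootOfUnity g) (n : ℕ+) :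
    cyclicResultant n g ∣ cyclicResultant n f := by
  have hR : cyclicResultant n g ≠ 0 := by
    rw [← Int.cast_ne_zero (α := ℂ), cyclicResultant_eq_prod n.pos, Finset.prod_ne_zero_iff]
    exact fun ζ hζ => hg.aeval_ne_zero n.pos hζ
  obtain ⟨p, q, -, -, e⟩ := exists_mul_add_mul_eq_C_resultant (X ^ (n : ℕ) - 1)
    (g.comp (X ^ a n)) (m := n) (by rw [← C_1, natDegree_X_pow_sub_C]) le_rfl (.inl n.ne_zero)
  change _ = C (cyclicResultant n (g.comp (X ^ a n))) at e
  rw [cyclicResultant_comp_X_pow n.pos (ha n)] at e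
  -- With `N` the absolute value of the resultant, `N` itself lies in `(X ^ n - 1, g(X ^ a))`. So
  -- `f` is a multiple of `g(X ^ a)` modulo `X ^ n - 1` alone, and the product over roots of unity
  -- gives the divisibility.
  obtain ⟨w, q', r, e'⟩ := h n ⟨(cyclicResultant n g).natAbs, Int.natAbs_pos.2 hR⟩
  obtain ⟨c, hc⟩ : cyclicResultant n g ∣ (((cyclicResultant n g).natAbs : ℕ) : ℤ) :=
    Int.dvd_natAbs.2 dvd_rfl
  rw [PNat.mk_coe, hc, C_mul, ← e] at e'
  refine ⟨cyclicResultant n (w + C c * r * q), ?_⟩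
  rw [← Int.cast_inj (α := ℂ), Int.cast_mul, cyclicResultant_eq_prod n.pos f,
    cyclicResultant_eq_prod n.pos g, cyclicResultant_eq_prod n.pos,
    ← prod_nthRootsFinset_pow n.pos (ha n) fun ζ => aeval ζ g, ← Finset.prod_mul_distrib]
  refine Finset.prod_congr rfl fun ζ hζ => ?_
  rw [mem_nthRootsFinset n.pos] at hζ
  conv_lhs => rw [e']
  simp [aeval_comp, hζ]
  ring

theorem TwistedMem.cyclicResultant_sq_eq {a b : ℕ+ → ℕ} (ha : ∀ n, (a n).Coprime n)
    (hb : ∀ n, (b n).Coprime n) {f g : ℤ[X]} (hfg : TwistedMem a f g) (hgf : TwistedMem b g f)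
    (hf : NoRootOfUnity f) (hg : NoRootOfUnity g) (n : ℕ+) :
    cyclicResultant n f ^ 2 = cyclicResultant n g ^ 2 :=
  Int.natAbs_eq_iff_sq_eq.1 <| Int.natAbs_eq_of_dvd_dvd (hgf.cyclicResultant_dvd hb hf n)
    (hfg.cyclicResultant_dvd ha hg n)

/-! ### Unique factorisation of products of `1 - [s]` in a group algebra -/

namespace MonoidAlgebra

section Ordered

variable {R G L : Type*} [CommRing R] [CommGroup G] [CommGroup L] [LinearOrder L]
  [IsOrderedMonoid L] (φ : G →* L)

theorem coeff_one_sub_single_mul (s h : G) (x : MonoidAlgebra R G) :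
    ((1 - single s 1) * x).coeff h = x.coeff h - x.coeff (s⁻¹ * h) := by
  rw [sub_mul, one_mul, coeff_sub, Finsupp.sub_apply, coeff_single_mul_apply, one_mul]

/-- At a support element of least `φ`-value, multiplication by `1 - [s]` leaves the coefficient
unchanged. -/
theorem eq_of_one_sub_single_mul_eq {s : G} (hs : 1 < φ s) {x y : MonoidAlgebra R G}
    (h : (1 - single s 1) * x = (1 - single s 1) * y) : x = y := by
  rw [← sub_eq_zero, ← mul_sub] at h
  rw [← sub_eq_zero]
  generalize x - y = z at h ⊢
  by_contra hz
  have hne : z.coeff.support.Nonempty := by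
    rw [Finsupp.support_nonempty_iff]
    exact fun e => hz (coeff_injective e)
  obtain ⟨g, hg, hmin⟩ := z.coeff.support.exists_min_image φ hne
  have h₁ := congrArg (fun w => w.coeff g) h
  simp only [coeff_one_sub_single_mul, coeff_zero, Finsupp.zero_apply] at h₁
  have h₂ : z.coeff (s⁻¹ * g) = 0 := by
    by_contra h₃
    have := hmin _ (Finsupp.mem_support_iff.2 h₃)
    rw [map_mul, map_inv, le_inv_mul_iff_mul_le, mul_le_iff_le_one_left'] at this
    exact this.not_gt hs
  rw [h₂, sub_zero] at h₁
  exact Finsupp.mem_support_iff.1 hg h₁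

open scoped Classical in
-- A product of two or more elements of `S` has `φ`-value above `φ h`, so only the empty product and
-- single factors contribute.
theorem coeff_prod_one_sub_single (S : Multiset G) (h : G) (hS : ∀ s ∈ S, 1 < φ s)
    (hh : ∀ s ∈ S, φ h ≤ φ s) :
    ((S.map fun s => (1 - single s 1 : MonoidAlgebra R G)).prod).coeff h =
      (if h = 1 then 1 else 0) - (S.count h : R) := by
  induction S using Multiset.induction_on generalizing h with
  | empty => simp [one_def, Finsupp.single_apply, eq_comm]
  | cons s S ih =>
    simp only [Multiset.mem_cons, forall_eq_or_imp] at hS hh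
    have hle : φ (s⁻¹ * h) ≤ 1 := by
      rw [map_mul, map_inv, inv_mul_le_one_iff]
      exact hh.1
    have hcount : S.count (s⁻¹ * h) = 0 :=
      Multiset.count_eq_zero.2 fun hm => (hS.2 _ hm).not_ge hle
    rw [Multiset.map_cons, Multiset.prod_cons, coeff_one_sub_single_mul, ih h hS.2 hh.2,
      ih _ hS.2 fun t ht => hle.trans (hS.2 t ht).le, hcount, Multiset.count_cons]
    simp only [inv_mul_eq_one, eq_comm (a := s)]
    split_ifs <;> push_cast <;> ring

/-- The coefficient at a `φ`-minimal element of `S + T` shows that it has the same multiplicity on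
both sides; cancel one such factor and induct. -/
theorem multiset_eq_of_prod_one_sub_single_eq [CharZero R] {S T : Multiset G}
    (hS : ∀ s ∈ S, 1 < φ s) (hT : ∀ s ∈ T, 1 < φ s)
    (h : (S.map fun s => (1 - single s 1 : MonoidAlgebra R G)).prod =
      (T.map fun s => (1 - single s 1 : MonoidAlgebra R G)).prod) : S = T := by
  classical
  induction hn : S.card generalizing S T with
  | zero =>
    rw [Multiset.card_eq_zero] at hn
    subst hn
    symm
    by_contra hne
    obtain ⟨t, ht, hmin⟩ := T.toFinset.exists_min_image φ
      (Multiset.toFinset_nonempty.2 hne)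
    simp only [Multiset.mem_toFinset] at ht hmin
    have h₁ := congrArg (fun x => x.coeff t) h
    simp only [coeff_prod_one_sub_single φ T t hT hmin,
      coeff_prod_one_sub_single φ 0 t hS (by simp)] at h₁
    rw [Multiset.count_zero, Nat.cast_zero, sub_zero, eq_comm, sub_eq_self, Nat.cast_eq_zero,
      Multiset.count_eq_zero] at h₁
    exact h₁ ht
  | succ n ih =>
    obtain ⟨t, ht, hmin⟩ := (S + T).toFinset.exists_min_image φ
      (Multiset.toFinset_nonempty.2 fun e => by simp [add_eq_zero.1 e] at hn)
    simp only [Multiset.mem_toFinset, Multiset.mem_add] at ht hmin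
    have h₁ := congrArg (fun x => x.coeff t) h
    simp only [coeff_prod_one_sub_single φ T t hT fun s hs => hmin s (.inr hs),
      coeff_prod_one_sub_single φ S t hS fun s hs => hmin s (.inl hs), sub_right_inj,
      Nat.cast_inj] at h₁
    rw [← Multiset.count_pos, ← Multiset.count_pos, h₁, or_self, Multiset.count_pos] at ht
    have ht' : t ∈ S := by rwa [← Multiset.count_pos, h₁, Multiset.count_pos]
    obtain ⟨S, rfl⟩ := Multiset.exists_cons_of_mem ht'
    obtain ⟨T, rfl⟩ := Multiset.exists_cons_of_mem ht
    simp only [Multiset.map_cons, Multiset.prod_cons] at h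
    rw [Multiset.card_cons, Nat.succ_inj] at hn
    simp only [Multiset.mem_cons, forall_eq_or_imp] at hS hT
    rw [ih hS.2 hT.2 (eq_of_one_sub_single_mul_eq φ hS.1 h) hn]

theorem eq_and_eq_of_single_mul_prod_eq [CharZero R] {S T : Multiset G} {c d : G}
    (hS : ∀ s ∈ S, 1 < φ s) (hT : ∀ s ∈ T, 1 < φ s)
    (h : single c 1 * (S.map fun s => (1 - single s 1 : MonoidAlgebra R G)).prod =
      single d 1 * (T.map fun s => (1 - single s 1 : MonoidAlgebra R G)).prod) :
    c = d ∧ S = T := by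
  classical
  have hcd : c = d := by
    wlog hle : φ c ≤ φ d generalizing c d S T
    · exact (this hT hS h.symm (le_of_not_ge hle)).symm
    have hd : φ (d⁻¹ * c) ≤ 1 := by
      rw [map_mul, map_inv, inv_mul_le_one_iff]
      exact hle
    have h₁ := congrArg (fun x => x.coeff c) h
    have hT' : T.count (d⁻¹ * c) = 0 :=
      Multiset.count_eq_zero.2 fun hm => (hT _ hm).not_ge hd
    have hS' : S.count 1 = 0 :=
      Multiset.count_eq_zero.2 fun hm => (hS _ hm).ne (map_one φ).symm
    simp only [coeff_single_mul_apply, inv_mul_cancel,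
      coeff_prod_one_sub_single φ S 1 hS fun s hs => (map_one φ).trans_le (hS s hs).le,
      coeff_prod_one_sub_single φ T _ hT fun s hs => hd.trans (hT s hs).le, hT', hS'] at h₁
    by_contra hne
    simp [inv_mul_eq_one, Ne.symm hne] at h₁
  subst hcd
  refine ⟨rfl, multiset_eq_of_prod_one_sub_single_eq φ (R := R) hS hT ?_⟩
  have := congrArg (fun x => single c⁻¹ 1 * x) h
  simpa [← mul_assoc, ← one_def] using this

theorem eq_filter_add_map_inv {M : Multiset G} (hM : M.map (·⁻¹) = M) (hφ : ∀ α ∈ M, φ α ≠ 1) :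
    M = M.filter (1 < φ ·) + (M.filter (1 < φ ·)).map (·⁻¹) := by
  have hneg : M.filter (¬ 1 < φ ·) = (M.filter (1 < φ ·)).map (·⁻¹) := by
    conv_lhs => rw [← hM]
    rw [Multiset.filter_map]
    congr 1
    refine Multiset.filter_congr fun α hα => ?_
    have := hφ α hα
    simp only [Function.comp, map_inv, one_lt_inv', not_lt]
    exact ⟨fun h => lt_of_le_of_ne h this.symm, le_of_lt⟩
  rw [← hneg, Multiset.filter_add_not]

/-- The product of `([α] - 1) ^ 2` over a family of elements that is stable under inversion. -/
theorem prod_single_sub_one_sq {M : Multiset G} (hM : M.map (·⁻¹) = M) (hφ : ∀ α ∈ M, φ α ≠ 1) :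
    (M.map fun α => (single α 1 - 1 : MonoidAlgebra R G) ^ 2).prod =
      single ((M.filter (1 < φ ·)).map (·⁻¹)).prod 1 ^ 2 *
        ((4 • M.filter (1 < φ ·)).map fun α => (1 - single α 1 : MonoidAlgebra R G)).prod := by
  conv_lhs => rw [eq_filter_add_map_inv φ hM hφ]
  generalize M.filter (1 < φ ·) = S
  rw [Multiset.map_add, Multiset.prod_add, Multiset.map_nsmul, Multiset.prod_nsmul,
    Multiset.map_map]
  induction S using Multiset.induction_on with
  | empty => simp [one_def]
  | cons s S ih =>
    simp only [Multiset.map_cons, Multiset.prod_cons]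
    have hinv : single s⁻¹ 1 * single s 1 = (1 : MonoidAlgebra R G) := by simp [one_def]
    -- Since `[s⁻¹] - 1 = [s⁻¹] * (1 - [s])`, an inverse pair of squares yields a fourth power.
    have e : ((single s 1 - 1 : MonoidAlgebra R G)) ^ 2 * ((single s⁻¹ 1 - 1) ^ 2) =
        single s⁻¹ 1 ^ 2 * (1 - single s 1) ^ 4 := by
      have : (single s⁻¹ 1 - 1 : MonoidAlgebra R G) = single s⁻¹ 1 * (1 - single s 1) := by
        rw [mul_sub, hinv, mul_one]
      rw [this]
      ring
    have e' : single (s⁻¹ * (S.map (·⁻¹)).prod) (1 : R) =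
      single s⁻¹ 1 * single (S.map (·⁻¹)).prod 1 := by simp
    rw [e', mul_mul_mul_comm, Function.comp_apply, e, ih]
    ring

end Ordered

/-! ### From power identities to the group algebra -/

/-- The homomorphism on the group algebra of `Kˣ` induced by the `n`-th power map. -/
noncomputable def powEval (K : Type*) [Field K] (n : ℕ) : MonoidAlgebra K Kˣ →ₐ[K] K :=
  lift K K Kˣ ((powMonoidHom n).comp (Units.coeHom K))

theorem powEval_single {K : Type*} [Field K] (n : ℕ) (u : Kˣ) :
    powEval K n (single u 1) = (u : K) ^ n := by
  simp [powEval]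

theorem eq_zero_of_forall_powEval_eq_zero {K : Type*} [Field K] {x : MonoidAlgebra K Kˣ}
    (h : ∀ n : ℕ, 0 < n → powEval K n x = 0) : x = 0 := by
  have hinj : Function.Injective fun u : Kˣ => powersHom K (u : K) := fun u v e =>
    Units.ext ((powersHom K).injective e)
  -- Scaling each character by `u` shifts the exponent `n` to `n + 1`, since vanishing is known only
  -- at positive exponents.
  have hli := ((linearIndependent_monoidHom (Multiplicative ℕ) K).comp _ hinj).units_smul
    (fun u : Kˣ => u)
  rw [linearIndependent_iff] at hli
  apply coeff_injective
  refine hli x.coeff ?_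
  ext n
  have := h (n.toAdd + 1) (Nat.succ_pos _)
  simp only [powEval, lift_apply] at this
  rw [Finsupp.linearCombination_apply, Finsupp.sum_apply']
  refine Eq.trans (Finsupp.sum_congr fun u _ => ?_) this
  simp [Units.smul_def, pow_succ']

end MonoidAlgebra

/-- Finitely many elements of infinite order are detected by one homomorphism to `ℚ`. -/
theorem exists_monoidHom_rat_ne_one {G : Type*} [CommGroup G] (F : Finset G)
    (hF : ∀ g ∈ F, ¬ IsOfFinOrder g) : ∃ φ : G →* Multiplicative ℚ, ∀ g ∈ F, φ g ≠ 1 := by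
  let ι := TensorProduct.mk ℤ ℚ (Additive G) 1
  have : IsLocalizedModule (nonZeroDivisors ℤ) ι :=
    (isLocalizedModule_iff_isBaseChange (nonZeroDivisors ℤ) ℚ _).2
      (TensorProduct.isBaseChange _ _ _)
  -- The kernel of `G → ℚ ⊗ G` is torsion, so the given elements have nonzero images, and one linear
  -- functional is nonzero on all of them.
  obtain ⟨f, hf⟩ := Module.exists_dual_forall_apply_ne_zero (K := ℚ)
    (fun g : F => ι (Additive.ofMul g.1)) (by
      rintro ⟨g, hg⟩ e
      obtain ⟨c, hc⟩ := (IsLocalizedModule.eq_zero_iff (nonZeroDivisors ℤ) ι).1 e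
      refine hF g hg (isOfFinOrder_iff_zpow_eq_one.2 ⟨c, nonZeroDivisors.coe_ne_zero c, ?_⟩)
      exact congrArg Additive.toMul hc)
  refine ⟨AddMonoidHom.toMultiplicativeRight
    ((f.toAddMonoidHom.comp ι.toAddMonoidHom : Additive G →+ ℚ)), fun g hg e => ?_⟩
  exact hf ⟨g, hg⟩ e

-- Both sides are values under `powEval` of elements of the group algebra, which must therefore be
-- equal. Choosing `φ` nontrivial on every element splits each multiset into a positive half and its
-- inverses; the halves are unique, and then so is the monomial factor, giving `A ^ 2 = B ^ 2`.
open MonoidAlgebra in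
theorem multiset_eq_of_forall_prod_pow_sub_one_sq_eq {K : Type*} [Field K] [CharZero K]
    {M M' : Multiset Kˣ} {A B : Kˣ} (hM : M.map (·⁻¹) = M) (hM' : M'.map (·⁻¹) = M')
    (ht : ∀ α ∈ M, ¬ IsOfFinOrder α) (ht' : ∀ α ∈ M', ¬ IsOfFinOrder α)
    (h : ∀ n : ℕ, 0 < n → (A : K) ^ (2 * n) * (M.map fun α : Kˣ => ((α : K) ^ n - 1) ^ 2).prod =
      (B : K) ^ (2 * n) * (M'.map fun α : Kˣ => ((α : K) ^ n - 1) ^ 2).prod) :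
    A ^ 2 = B ^ 2 ∧ M = M' := by
  classical
  obtain ⟨φ, hφ⟩ := exists_monoidHom_rat_ne_one (M + M').toFinset (by
    simp only [Multiset.mem_toFinset, Multiset.mem_add]
    exact fun g hg => hg.elim (ht g) (ht' g))
  simp only [Multiset.mem_toFinset, Multiset.mem_add] at hφ
  have hφM : ∀ α ∈ M, φ α ≠ 1 := fun α hα => hφ α (.inl hα)
  have hφM' : ∀ α ∈ M', φ α ≠ 1 := fun α hα => hφ α (.inr hα)
  have key : single (A ^ 2) 1 * (M.map fun α => (single α 1 - 1 : MonoidAlgebra K Kˣ) ^ 2).prod =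
      single (B ^ 2) 1 * (M'.map fun α => (single α 1 - 1 : MonoidAlgebra K Kˣ) ^ 2).prod := by
    rw [← sub_eq_zero]
    apply eq_zero_of_forall_powEval_eq_zero
    intro n hn
    rw [map_sub, sub_eq_zero]
    simpa [map_multiset_prod, Multiset.map_map, powEval_single, ← pow_mul] using h n hn
  have hpos : ∀ N : Multiset Kˣ, ∀ α ∈ 4 • N.filter (1 < φ ·), 1 < φ α := fun N α hα =>
    (Multiset.mem_filter.1 (Multiset.mem_of_mem_nsmul hα)).2
  rw [prod_single_sub_one_sq φ hM hφM, prod_single_sub_one_sq φ hM' hφM', ← mul_assoc, ← mul_assoc,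
    single_pow, single_pow, single_mul_single, single_mul_single, one_pow, mul_one] at key
  obtain ⟨h₁, h₂⟩ := eq_and_eq_of_single_mul_prod_eq φ (hpos M) (hpos M') key
  have h₃ : M.filter (1 < φ ·) = M'.filter (1 < φ ·) := by
    ext α
    have := congrArg (Multiset.count α) h₂
    rw [Multiset.count_nsmul, Multiset.count_nsmul] at this
    omega
  rw [h₃, mul_left_inj] at h₁
  refine ⟨h₁, ?_⟩
  rw [eq_filter_add_map_inv φ hM hφM, h₃, ← eq_filter_add_map_inv φ hM' hφM']

/-! ### Roots of reciprocal polynomials -/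

theorem reverse_X_sub_C_eq {K : Type*} [Field K] {α : K} (hα : α ≠ 0) :
    (X - C α : K[X]).reverse = C (-α) * (X - C α⁻¹) := by
  have h1 : (1 : K[X]).reverse = 1 := by rw [← C_1, reverse_C]
  have hX : (X : K[X]).reverse = 1 := by rw [← one_mul X, reverse_mul_X, h1]
  rw [sub_eq_add_neg, ← C_neg, reverse_add_C, natDegree_X, pow_one, hX, mul_sub, ← C_mul, neg_mul,
    mul_inv_cancel₀ hα, C_neg, C_neg, C_1]
  ring

theorem roots_reverse_prod_X_sub_C {K : Type*} [Field K] (s : Multiset K) (hs : 0 ∉ s) :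
    ((s.map (X - C ·)).prod.reverse).roots = s.map (·⁻¹) := by
  induction s using Multiset.induction_on with
  | empty =>
    rw [Multiset.map_zero, Multiset.prod_zero, ← C_1, reverse_C, roots_C, Multiset.map_zero]
  | cons α s ih =>
    rw [Multiset.mem_cons, not_or] at hs
    have hne : ((s.map (X - C ·)).prod.reverse) ≠ 0 :=
      reverse_eq_zero.not.2 (monic_multiset_prod_of_monic _ _ fun a _ => monic_X_sub_C a).ne_zero
    rw [Multiset.map_cons, Multiset.prod_cons, reverse_mul_of_domain,
      reverse_X_sub_C_eq (Ne.symm hs.1), mul_assoc, roots_C_mul _ (neg_ne_zero.2 (Ne.symm hs.1)),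
      roots_mul (mul_ne_zero (X_sub_C_ne_zero _) hne), ih hs.2, roots_X_sub_C, Multiset.map_cons,
      Multiset.singleton_add]

theorem Polynomial.Splits.roots_reverse {K : Type*} [Field K] {p : K[X]} (hp : p.Splits)
    (h0 : p.coeff 0 ≠ 0) : p.reverse.roots = p.roots.map (·⁻¹) := by
  have hp0 : p ≠ 0 := fun e => h0 (by simp [e])
  have hs : 0 ∉ p.roots := fun hm => h0 (by
    rw [coeff_zero_eq_eval_zero]
    exact (mem_roots hp0).1 hm)
  conv_lhs => rw [hp.eq_prod_roots, reverse_mul_of_domain, reverse_C,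
    roots_C_mul _ (leadingCoeff_ne_zero.2 hp0), roots_reverse_prod_X_sub_C _ hs]

/-- The multiset of complex roots. -/
noncomputable abbrev complexRoots (f : ℤ[X]) : Multiset ℂ := (f.map (algebraMap ℤ ℂ)).roots

theorem map_complex_ne_zero {f : ℤ[X]} (hf : f ≠ 0) : f.map (algebraMap ℤ ℂ) ≠ 0 :=
  (Polynomial.map_ne_zero_iff (algebraMap ℤ ℂ).injective_int).2 hf

theorem mem_complexRoots {f : ℤ[X]} (hf : f ≠ 0) {z : ℂ} : z ∈ complexRoots f ↔ aeval z f = 0 := by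
  rw [mem_roots (map_complex_ne_zero hf), IsRoot, eval_map_algebraMap]

theorem IsReciprocal.reverse_eq {f : ℤ[X]} (hf : IsReciprocal f) : f.reverse = f := by
  ext i
  rw [coeff_reverse]
  by_cases hi : i ≤ f.natDegree
  · rw [revAt_le hi, hf i hi]
  · rw [revAt_eq_self_of_lt (not_le.1 hi)]

theorem IsReciprocal.coeff_zero_ne_zero {f : ℤ[X]} (hf : IsReciprocal f) (h0 : f ≠ 0) :
    f.coeff 0 ≠ 0 := by
  rw [hf 0 (Nat.zero_le _), Nat.sub_zero]
  exact leadingCoeff_ne_zero.2 h0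

theorem IsReciprocal.map_inv_complexRoots {f : ℤ[X]} (hf : IsReciprocal f) (h0 : f ≠ 0) :
    (complexRoots f).map (·⁻¹) = complexRoots f := by
  have hc : (f.map (algebraMap ℤ ℂ)).coeff 0 ≠ 0 := by
    simpa using hf.coeff_zero_ne_zero h0
  have hr : (f.map (algebraMap ℤ ℂ)).reverse = f.map (algebraMap ℤ ℂ) := by
    conv_rhs => rw [← hf.reverse_eq]
    rw [reverse, reverse, reflect_map,
      natDegree_map_eq_of_injective (algebraMap ℤ ℂ).injective_int]
  rw [complexRoots, ← (IsAlgClosed.splits _).roots_reverse hc, hr]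

/-- The roots of `f₀` are exactly the roots of `P * f₀` that are not roots of unity, a condition
stable under inversion. Reciprocity of `f₀` itself is not needed. -/
theorem map_inv_complexRoots_of_mul {P f₀ : ℤ[X]} (hf : IsReciprocal (P * f₀)) (h0 : P * f₀ ≠ 0)
    (hP : ∀ z : ℂ, aeval z P = 0 → ∃ n : ℕ, 0 < n ∧ z ^ n = 1) (h₀ : NoRootOfUnity f₀) :
    (complexRoots f₀).map (·⁻¹) = complexRoots f₀ := by
  classical
  have hfilter : complexRoots f₀ =
      (complexRoots (P * f₀)).filter fun z => ∀ n : ℕ, 0 < n → z ^ n ≠ 1 := by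
    rw [complexRoots, complexRoots, Polynomial.map_mul, roots_mul (by
      rw [← Polynomial.map_mul]; exact map_complex_ne_zero h0), Multiset.filter_add,
      Multiset.filter_eq_nil.2, zero_add, Multiset.filter_eq_self.2]
    · exact fun z hz => h₀ z ((mem_complexRoots (right_ne_zero_of_mul h0)).1 hz)
    · intro z hz hn
      obtain ⟨n, hn₀, e⟩ := hP z ((mem_complexRoots (left_ne_zero_of_mul h0)).1 hz)
      exact hn n hn₀ e
  rw [hfilter]
  conv_rhs => rw [← hf.map_inv_complexRoots h0, Multiset.filter_map]
  congr 1
  refine Multiset.filter_congr fun z _ => ?_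
  simp

theorem exists_units_map_eq_complexRoots {f : ℤ[X]} (h : f.coeff 0 ≠ 0) :
    ∃ M : Multiset ℂˣ, M.map (fun u : ℂˣ => (u : ℂ)) = complexRoots f := by
  have hf : f ≠ 0 := fun e => h (by simp [e])
  have hz : ∀ z ∈ complexRoots f, z ≠ 0 := by
    rintro z hz rfl
    rw [mem_complexRoots hf, ← coeff_zero_eq_aeval_zero', eq_intCast, Int.cast_eq_zero] at hz
    exact h hz
  lift complexRoots f to Multiset ℂˣ using fun z hm => isUnit_iff_ne_zero.2 (hz z hm) with M
  exact ⟨M, rfl⟩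

/-! ### Recovering the polynomial from its resultants, and conclusion -/

theorem eq_or_eq_neg_of_cyclicResultant_sq_eq {f g : ℤ[X]} (hf0 : f.coeff 0 ≠ 0)
    (hg0 : g.coeff 0 ≠ 0) (hf : NoRootOfUnity f) (hg : NoRootOfUnity g)
    (hfi : (complexRoots f).map (·⁻¹) = complexRoots f)
    (hgi : (complexRoots g).map (·⁻¹) = complexRoots g)
    (h : ∀ n : ℕ+, cyclicResultant n f ^ 2 = cyclicResultant n g ^ 2) : f = g ∨ f = -g := by
  have hinj : Function.Injective fun u : ℂˣ => (u : ℂ) := fun _ _ => Units.ext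
  have hmap : ∀ {f : ℤ[X]} {M : Multiset ℂˣ}, M.map (fun u : ℂˣ => (u : ℂ)) = complexRoots f →
      (complexRoots f).map (·⁻¹) = complexRoots f → M.map (·⁻¹) = M := by
    intro f M hM hi
    apply Multiset.map_injective hinj
    rw [hM, ← hi, ← hM, Multiset.map_map, Multiset.map_map]
    simp
  have htor : ∀ {f : ℤ[X]} {M : Multiset ℂˣ}, M.map (fun u : ℂˣ => (u : ℂ)) = complexRoots f →
      f.coeff 0 ≠ 0 → NoRootOfUnity f → ∀ α ∈ M, ¬ IsOfFinOrder α := by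
    intro f M hM h0 hf α hα hfin
    obtain ⟨n, hn, e⟩ := isOfFinOrder_iff_pow_eq_one.1 hfin
    have hm : (α : ℂ) ∈ complexRoots f := hM ▸ Multiset.mem_map_of_mem _ hα
    rw [mem_complexRoots fun e => h0 (by simp [e])] at hm
    exact hf _ hm n hn (by rw [← Units.val_pow_eq_pow_val, e, Units.val_one])
  have hlc : ∀ {f : ℤ[X]}, f.coeff 0 ≠ 0 → (f.leadingCoeff : ℂ) ≠ 0 := fun h0 =>
    Int.cast_ne_zero.2 (leadingCoeff_ne_zero.2 fun e => h0 (by simp [e]))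
  obtain ⟨M, hM⟩ := exists_units_map_eq_complexRoots hf0
  obtain ⟨M', hM'⟩ := exists_units_map_eq_complexRoots hg0
  obtain ⟨hAB, rfl⟩ := multiset_eq_of_forall_prod_pow_sub_one_sq_eq
    (A := Units.mk0 _ (hlc hf0)) (B := Units.mk0 _ (hlc hg0)) (hmap hM hfi) (hmap hM' hgi)
    (htor hM hf0 hf) (htor hM' hg0 hg) (by
      intro n hn
      have e := congrArg (Int.cast : ℤ → ℂ) (h ⟨n, hn⟩)
      rw [Int.cast_pow, Int.cast_pow, PNat.mk_coe, cyclicResultant_sq, cyclicResultant_sq] at e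
      change _ * ((complexRoots f).map _).prod = _ * ((complexRoots g).map _).prod at e
      rw [← hM, ← hM', Multiset.map_map, Multiset.map_map] at e
      exact e)
  have hroots : complexRoots f = complexRoots g := hM.symm.trans hM'
  have hcoef : f.leadingCoeff ^ 2 = g.leadingCoeff ^ 2 := by
    have := congrArg Units.val hAB
    simp only [Units.val_pow_eq_pow_val, Units.val_mk0] at this
    exact_mod_cast this
  have hprod : ∀ f : ℤ[X], f.map (algebraMap ℤ ℂ) =
      C (f.leadingCoeff : ℂ) * ((complexRoots f).map (X - C ·)).prod := fun f => by
    conv_lhs => rw [(IsAlgClosed.splits (f.map (algebraMap ℤ ℂ))).eq_prod_roots,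
      leadingCoeff_map_of_injective (algebraMap ℤ ℂ).injective_int]
    rfl
  have hmi := map_injective (algebraMap ℤ ℂ) (algebraMap ℤ ℂ).injective_int
  refine (sq_eq_sq_iff_eq_or_eq_neg.1 hcoef).imp (fun e => hmi ?_) fun e => hmi ?_
  · rw [hprod, hprod g, e, hroots]
  · rw [Polynomial.map_neg, hprod, hprod g, e, hroots]
    simp

theorem lemma3p6 (f g : ℤ[X]) (hf : IsReciprocal f) (hg : IsReciprocal g) (v : ZHatˣ)
    (h : Ideal.span {evalTPow 1 f} = Ideal.span {evalTPow (v : ZHat) g}) :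
    ∃ u : (ℤ[T;T⁻¹])ˣ, Polynomial.toLaurent f = (u : ℤ[T;T⁻¹]) * Polynomial.toLaurent g := by
  have hfg : TwistedMem (residue (v : ZHat)) f g :=
    twistedMem_of_mem_span (h ▸ Ideal.mem_span_singleton_self _)
  have hgf : TwistedMem (residue ((v⁻¹ : ZHatˣ) : ZHat)) g f :=
    twistedMem_inv_of_mem_span (h ▸ Ideal.mem_span_singleton_self _)
  suffices f = g ∨ f = -g by
    rcases this with rfl | rfl
    · exact ⟨1, by simp⟩
    · exact ⟨-1, by simp⟩
  by_cases hf0 : f = 0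
  · subst hf0
    exact .inl hgf.eq_zero_of_zero_right.symm
  have hg0 : g ≠ 0 := by
    rintro rfl
    exact hf0 hfg.eq_zero_of_zero_right
  obtain ⟨P, f₀, g₀, rfl, rfl, h₁, h₂, h₃, h₄, h₅⟩ := hfg.exists_strip_cyclotomic
    (residue_coprime v) (residue_coprime v⁻¹) (fun _ _ => residue_modEq _)
    (fun _ _ => residue_modEq _) f g hf0 hgf
  have hcf := hf.coeff_zero_ne_zero hf0
  have hcg := hg.coeff_zero_ne_zero hg0
  rw [mul_coeff_zero] at hcf hcg
  refine (eq_or_eq_neg_of_cyclicResultant_sq_eq (right_ne_zero_of_mul hcf)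
    (right_ne_zero_of_mul hcg) h₃ h₄ (map_inv_complexRoots_of_mul hf hf0 h₅ h₃)
    (map_inv_complexRoots_of_mul hg hg0 h₅ h₄)
    (h₁.cyclicResultant_sq_eq (residue_coprime v) (residue_coprime v⁻¹) h₂ h₃ h₄)).imp ?_ ?_
  · rintro rfl
    rfl
  · rintro rfl
    rw [mul_neg]
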